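/- Let $\mathbb G_1$ be the directed graph with vertex set $\mathbb Z^2$ in which $(v,w)=((v_1,v_2),(w_1,w_2))$ is an edge if and only if $w=(v_1,v_2\pm1)$, or $w=(v_1+1,v_2)$ and $v_2\ge 0$, or $w=(v_1-1,v_2)$ and $v_2<0$. Let $(M_n)_{n\ge0}$ be the simple random walk on $\mathbb G_1$, that is, the Markov chain on $\mathbb Z^2$ which from each vertex moves to one of its (three) out-neighbours chosen uniformly at random, and write $\mathbb P_v$ for its law when started at $v$. Then the simple random walk on $\mathbb G_1$ is transient: for every $v\in\mathbb Z^2$, $$\mathbb P_v\big(M_n=v\text{ for some }n\ge1\big)<1,\qquad\text{and}\qquad \sum_{n\ge0}\mathbb P_v(M_n=v)<\infty .$$ -/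

import Mathlib

open MeasureTheory
open scoped ENNReal

/-- The partially directed square lattice: every vertex of `ℤ × ℤ` has edges to its two vertical
neighbours; horizontal edges point to the right on the lines of ordinate `≥ 0` and to the left on
the lines of ordinate `< 0`. -/
def latticeG1 : Digraph (ℤ × ℤ) where
  Adj v w :=
    w = (v.1, v.2 + 1) ∨ w = (v.1, v.2 - 1) ∨
      (w = (v.1 + 1, v.2) ∧ 0 ≤ v.2) ∨ (w = (v.1 - 1, v.2) ∧ v.2 < 0)

open Classical in
/-- One-step transition probability of the simple random walk on a directed graph with finite
nonempty sets of out-neighbours: from `v` the walk moves to an out-neighbour chosen uniformly. -/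
noncomputable def simpleStepProb {V : Type*} (G : Digraph V) (v w : V) : ℝ≥0∞ :=
  if G.Adj v w then (({u | G.Adj v u}.ncard : ℕ) : ℝ≥0∞)⁻¹ else 0

/-- `M` is, under the probability measure `μ`, a simple random walk on `G` started at `v`, i.e. the
Markov chain on the countable set `V` with initial state `v` and transition probabilities
`simpleStepProb G`: the conditional probability of `M (n + 1) = w` given
`M 0 = x 0, …, M n = x n` is `simpleStepProb G (x n) w` (written without division). -/
structure IsSimpleRandomWalk {V : Type*} [Countable V] [MeasurableSpace V]
    [MeasurableSingletonClass V] (G : Digraph V) (v : V)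
    {Ω : Type*} [MeasurableSpace Ω] (μ : Measure Ω) (M : ℕ → Ω → V) : Prop where
  measurable : ∀ n, Measurable (M n)
  start : ∀ᵐ ω ∂μ, M 0 ω = v
  markov : ∀ (n : ℕ) (x : ℕ → V) (w : V),
    μ {ω | (∀ i ≤ n, M i ω = x i) ∧ M (n + 1) ω = w} =
      μ {ω | ∀ i ≤ n, M i ω = x i} * simpleStepProb G (x n) w

/-! For every vertex `w` there is a bounded `F` with `F - P F = δ_w`, where `P` is the transition
operator. Then `∑_{k<n} ℙ(M_k = w) = 𝔼 F(M_0) - 𝔼 F(M_n)` is bounded uniformly in `n`, so the Green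
series converges. Stopping the same identity at the first return to `v` bounds below the probability
of never returning.

For `w = 0`, `F` comes from a Fourier transform in the horizontal variable. At frequency `θ`, with
`e = exp (iθ)`, the equation becomes a vertical recurrence with coefficient `3 - e` above and its
conjugate below. Its decaying solution is `a λ^y` for `y ≥ 0` and `a (conj λ)^(-y)` for `y < 0`,
where `λ² - (3 - e) λ + 1 = 0`; the unit charge at height `0` forces `a = 3λ / (1 - |λ|²)`. The
opposite orientations make the two roots conjugate, and `1 - |λ|²` is at least of order `|θ|^(1/2)`,
so `a` is integrable (`norm_amplitude_le`, `integrable_amplitude`) and the inverse transform is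
bounded. Symmetries and an induction on the height carry the charge to any vertex. -/

open ComplexConjugate
open scoped Real

/-! ### The decaying root `λ` and the size of the amplitude -/

/-- The image of `3 - e` under the Cayley transform `w ↦ (w - 2) / (w + 2)`. -/
noncomputable def symbolRatio (e : ℂ) : ℂ := (1 - e) / (5 - e)

/-- The real part of `halfPlaneRoot e`. -/
noncomputable def rootRe (e : ℂ) : ℝ := √((‖symbolRatio e‖ + (symbolRatio e).re) / 2)

/-- The square root of `symbolRatio e` in the right half-plane. -/
noncomputable def halfPlaneRoot (e : ℂ) : ℂ :=
  (rootRe e : ℂ) + ((symbolRatio e).im / (2 * rootRe e) : ℝ) * Complex.I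

/-- The root in the unit disc of `X ^ 2 - (3 - e) * X + 1`. -/
noncomputable def decayRoot (e : ℂ) : ℂ := (1 - halfPlaneRoot e) / (1 + halfPlaneRoot e)

/-- The value at height `0` of the Fourier transform of the potential kernel. -/
noncomputable def amplitude (e : ℂ) : ℂ := 3 * decayRoot e / (1 - decayRoot e * conj (decayRoot e))

theorem five_sub_ne_zero {e : ℂ} (he : ‖e‖ = 1) : 5 - e ≠ 0 := by
  intro h
  have : e = 5 := by linear_combination -h
  rw [this] at he
  norm_num at he

/-- The real part of `(1 - e) * conj (5 - e)` is `6 (1 - Re e)`. The square root therefore stays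
within an angle `π/4` of the real axis, and its real part is comparable to its modulus. -/
theorem symbolRatio_re_nonneg {e : ℂ} (he : ‖e‖ = 1) : 0 ≤ (symbolRatio e).re := by
  have h1 : e.re * e.re + e.im * e.im = 1 := by
    rw [← Complex.normSq_apply, Complex.normSq_eq_norm_sq, he]; norm_num
  have h2 : e.re ≤ 1 := he ▸ Complex.re_le_norm e
  have hn : 0 ≤ Complex.normSq (5 - e) := Complex.normSq_nonneg _
  rw [symbolRatio, Complex.div_re, ← add_div]
  refine div_nonneg ?_ hn
  simp
  nlinarith

theorem norm_symbolRatio_ge {e : ℂ} (he : ‖e‖ = 1) : ‖1 - e‖ / 6 ≤ ‖symbolRatio e‖ := by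
  rw [symbolRatio, norm_div]
  have h5 : 0 < ‖5 - e‖ := norm_pos_iff.2 (five_sub_ne_zero he)
  have : ‖5 - e‖ ≤ 6 := by
    calc ‖5 - e‖ ≤ ‖(5 : ℂ)‖ + ‖e‖ := norm_sub_le _ _
      _ = 6 := by rw [he]; norm_num
  exact div_le_div_of_nonneg_left (norm_nonneg _) h5 this

theorem rootRe_ge {e : ℂ} (he : ‖e‖ = 1) : √(‖1 - e‖ / 12) ≤ rootRe e := by
  refine Real.sqrt_le_sqrt ?_
  have := norm_symbolRatio_ge he
  have := symbolRatio_re_nonneg he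
  linarith

theorem rootRe_pos {e : ℂ} (he : ‖e‖ = 1) (h1 : e ≠ 1) : 0 < rootRe e := by
  refine lt_of_lt_of_le (Real.sqrt_pos.2 ?_) (rootRe_ge he)
  have : 0 < ‖1 - e‖ := norm_pos_iff.2 (sub_ne_zero.2 h1.symm)
  positivity

theorem halfPlaneRoot_re (e : ℂ) : (halfPlaneRoot e).re = rootRe e := by
  simp [halfPlaneRoot, -Complex.ofReal_div, -Complex.ofReal_mul]

theorem halfPlaneRoot_sq {e : ℂ} (he : ‖e‖ = 1) (h1 : e ≠ 1) :
    halfPlaneRoot e ^ 2 = symbolRatio e := by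
  have hpos := rootRe_pos he h1
  have hsq : rootRe e ^ 2 = (‖symbolRatio e‖ + (symbolRatio e).re) / 2 :=
    Real.sq_sqrt (by have := symbolRatio_re_nonneg he; positivity)
  have hnorm : ‖symbolRatio e‖ ^ 2 = (symbolRatio e).re ^ 2 + (symbolRatio e).im ^ 2 := by
    rw [← Complex.normSq_eq_norm_sq, Complex.normSq_apply]; ring
  have him : (halfPlaneRoot e).im = (symbolRatio e).im / (2 * rootRe e) := by
    simp [halfPlaneRoot, -Complex.ofReal_div, -Complex.ofReal_mul]
  apply Complex.ext
  · rw [pow_two, Complex.mul_re, halfPlaneRoot_re, him]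
    field_simp
    have : ‖symbolRatio e‖ = 2 * rootRe e ^ 2 - (symbolRatio e).re := by linarith
    rw [this] at hnorm
    nlinarith
  · rw [pow_two, Complex.mul_im, halfPlaneRoot_re, him]
    field_simp
    ring

theorem one_add_halfPlaneRoot_ne_zero (e : ℂ) : 1 + halfPlaneRoot e ≠ 0 := by
  intro h
  have := congrArg Complex.re h
  have h0 : 0 ≤ rootRe e := Real.sqrt_nonneg _
  simp [halfPlaneRoot_re] at this
  linarith

theorem decayRoot_quadratic {e : ℂ} (he : ‖e‖ = 1) (h1 : e ≠ 1) :
    decayRoot e ^ 2 + 1 = (3 - e) * decayRoot e := by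
  have h := halfPlaneRoot_sq he h1
  have h5 := five_sub_ne_zero he
  have ht := one_add_halfPlaneRoot_ne_zero e
  rw [symbolRatio, eq_div_iff h5] at h
  rw [decayRoot]
  field_simp
  linear_combination h

/-- `1 - |λ|²` in terms of the Cayley parameter. -/
theorem one_sub_normSq_decayRoot (e : ℂ) :
    1 - ‖decayRoot e‖ ^ 2 = 4 * rootRe e / ‖1 + halfPlaneRoot e‖ ^ 2 := by
  have ht : ‖1 + halfPlaneRoot e‖ ≠ 0 := norm_ne_zero_iff.2 (one_add_halfPlaneRoot_ne_zero e)
  rw [decayRoot, norm_div]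
  field_simp
  rw [← Complex.normSq_eq_norm_sq, ← Complex.normSq_eq_norm_sq, Complex.normSq_apply,
    Complex.normSq_apply, ← halfPlaneRoot_re]
  simp
  ring

theorem norm_decayRoot_le_one (e : ℂ) : ‖decayRoot e‖ ≤ 1 := by
  have h := one_sub_normSq_decayRoot e
  have h0 : 0 ≤ rootRe e := Real.sqrt_nonneg _
  have : 0 ≤ 4 * rootRe e / ‖1 + halfPlaneRoot e‖ ^ 2 := by positivity
  have h3 : ‖decayRoot e‖ ^ 2 ≤ 1 := by linarith
  exact (sq_le_one_iff₀ (norm_nonneg _)).1 h3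

theorem decayRoot_mul_conj (e : ℂ) :
    1 - decayRoot e * conj (decayRoot e) = ((1 - ‖decayRoot e‖ ^ 2 : ℝ) : ℂ) := by
  rw [Complex.mul_conj, Complex.normSq_eq_norm_sq]; push_cast; ring

theorem one_sub_normSq_decayRoot_pos {e : ℂ} (he : ‖e‖ = 1) (h1 : e ≠ 1) :
    0 < 1 - ‖decayRoot e‖ ^ 2 := by
  rw [one_sub_normSq_decayRoot]
  have := rootRe_pos he h1
  have ht : ‖1 + halfPlaneRoot e‖ ≠ 0 := norm_ne_zero_iff.2 (one_add_halfPlaneRoot_ne_zero e)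
  positivity

theorem amplitude_mul {e : ℂ} (he : ‖e‖ = 1) (h1 : e ≠ 1) :
    amplitude e * (1 - decayRoot e * conj (decayRoot e)) = 3 * decayRoot e := by
  refine div_mul_cancel₀ _ ?_
  rw [decayRoot_mul_conj]
  exact_mod_cast (one_sub_normSq_decayRoot_pos he h1).ne'

/-- With `t = halfPlaneRoot e`, the modulus is `3 |1 - t²| / (4 Re t)`. Here `1 - t² = 4 / (5 - e)`
has modulus at most `1`, and `Re t` is bounded below by `rootRe_ge`. -/
theorem norm_amplitude_le {e : ℂ} (he : ‖e‖ = 1) (h1 : e ≠ 1) :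
    ‖amplitude e‖ ≤ 3 * (√(‖1 - e‖ / 12))⁻¹ := by
  have ht : ‖1 + halfPlaneRoot e‖ ≠ 0 := norm_ne_zero_iff.2 (one_add_halfPlaneRoot_ne_zero e)
  have hr := rootRe_pos he h1
  have h4 : 4 ≤ ‖5 - e‖ := by
    have := norm_sub_norm_le (5 : ℂ) e
    rw [he] at this
    norm_num at this
    linarith
  have hprod : ‖1 - halfPlaneRoot e‖ * ‖1 + halfPlaneRoot e‖ ≤ 1 := by
    rw [← norm_mul]
    have : (1 - halfPlaneRoot e) * (1 + halfPlaneRoot e) = 4 / (5 - e) := by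
      have h5 := five_sub_ne_zero he
      have h := halfPlaneRoot_sq he h1
      rw [symbolRatio, eq_div_iff h5] at h
      rw [eq_div_iff h5]
      linear_combination -h
    rw [this, norm_div]
    norm_num
    exact (div_le_one (by linarith)).2 h4
  have hval : ‖amplitude e‖ =
      3 * (‖1 - halfPlaneRoot e‖ * ‖1 + halfPlaneRoot e‖) / (4 * rootRe e) := by
    rw [amplitude, decayRoot_mul_conj, norm_div, Complex.norm_real,
      Real.norm_of_nonneg (one_sub_normSq_decayRoot_pos he h1).le, one_sub_normSq_decayRoot,
      decayRoot, norm_mul, norm_div]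
    norm_num
    field_simp
  rw [hval]
  have hs : 0 < √(‖1 - e‖ / 12) :=
    Real.sqrt_pos.2 (by have : 0 < ‖1 - e‖ := norm_pos_iff.2 (sub_ne_zero.2 h1.symm); positivity)
  have hge := rootRe_ge he
  calc 3 * (‖1 - halfPlaneRoot e‖ * ‖1 + halfPlaneRoot e‖) / (4 * rootRe e)
      ≤ 3 * 1 / (1 * √(‖1 - e‖ / 12)) := by
        gcongr
        linarith
    _ = _ := by rw [mul_one, one_mul, div_eq_mul_inv]

@[fun_prop] theorem measurable_decayRoot : Measurable decayRoot := by
  unfold decayRoot halfPlaneRoot rootRe symbolRatio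
  fun_prop

@[fun_prop] theorem measurable_amplitude : Measurable amplitude := by
  unfold amplitude
  fun_prop

/-! ### Solving the vertical recurrence -/

/-- The Fourier mode of the potential kernel, as a function of the ordinate. -/
noncomputable def verticalMode (e : ℂ) (y : ℤ) : ℂ :=
  amplitude e * if 0 ≤ y then decayRoot e ^ y.toNat else conj (decayRoot e) ^ (-y).toNat

@[fun_prop] theorem measurable_verticalMode (y : ℤ) : Measurable fun e => verticalMode e y := by
  unfold verticalMode
  split_ifs <;> fun_prop

theorem norm_verticalMode_le (e : ℂ) (y : ℤ) : ‖verticalMode e y‖ ≤ ‖amplitude e‖ := by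
  rw [verticalMode, norm_mul]
  refine mul_le_of_le_one_right (norm_nonneg _) ?_
  split_ifs
  · rw [norm_pow]; exact pow_le_one₀ (norm_nonneg _) (norm_decayRoot_le_one e)
  · rw [norm_pow, RCLike.norm_conj]; exact pow_le_one₀ (norm_nonneg _) (norm_decayRoot_le_one e)

theorem verticalMode_equation {e : ℂ} (he : ‖e‖ = 1) (h1 : e ≠ 1) (y : ℤ) :
    verticalMode e y - (verticalMode e (y + 1) + verticalMode e (y - 1) +
      (if 0 ≤ y then e else conj e) * verticalMode e y) / 3 = if y = 0 then 1 else 0 := by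
  have hq := decayRoot_quadratic he h1
  have ha := amplitude_mul he h1
  have hq' : conj (decayRoot e) ^ 2 + 1 = (3 - conj e) * conj (decayRoot e) := by
    have := congrArg conj hq
    simpa [Complex.conj_ofNat] using this
  have hne : decayRoot e ≠ 0 := by
    intro h; rw [h] at hq; simp at hq
  obtain ⟨k, rfl | rfl⟩ := y.eq_nat_or_neg
  · cases k with
    | zero =>
      simp only [verticalMode]
      norm_num
      -- Multiplied by `λ`, the quadratic replaces `(3 - e) λ` by `λ² + 1`, leaving `a (1 - λ conj
      -- λ) = 3 λ`.
      refine mul_left_cancel₀ hne ?_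
      linear_combination (-amplitude e / 3) * hq + ha / 3
    | succ k =>
      have e1 : ((k + 1 : ℕ) : ℤ) + 1 = ((k + 2 : ℕ) : ℤ) := by push_cast; ring
      have e2 : ((k + 1 : ℕ) : ℤ) - 1 = ((k : ℕ) : ℤ) := by push_cast; ring
      rw [e1, e2]
      simp only [verticalMode, Int.natCast_nonneg, if_true, Int.toNat_natCast]
      rw [if_neg (by omega)]
      linear_combination (-amplitude e * decayRoot e ^ k / 3) * hq
  · cases k with
    | zero =>
      simp only [verticalMode]
      norm_num
      refine mul_left_cancel₀ hne ?_
      linear_combination (-amplitude e / 3) * hq + ha / 3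
    | succ k =>
      have hm : ∀ j : ℕ, verticalMode e (-(j : ℤ)) = amplitude e * conj (decayRoot e) ^ j := by
        intro j
        cases j with
        | zero => simp [verticalMode]
        | succ j =>
          rw [verticalMode, if_neg (by omega), neg_neg, Int.toNat_natCast]
      have e1 : -((k + 1 : ℕ) : ℤ) - 1 = -((k + 2 : ℕ) : ℤ) := by push_cast; ring
      have e2 : -((k + 1 : ℕ) : ℤ) + 1 = -((k : ℕ) : ℤ) := by push_cast; ring
      rw [e1, e2, hm, hm, hm, if_neg (by omega), if_neg (by omega)]
      linear_combination (-amplitude e * conj (decayRoot e) ^ k / 3) * hq'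

/-! ### Integration over the unit circle -/

/-- The point `exp (i θ)` of the unit circle. -/
noncomputable def unitPoint (θ : ℝ) : ℂ := Complex.exp (Complex.I * θ)

theorem norm_unitPoint (θ : ℝ) : ‖unitPoint θ‖ = 1 := Complex.norm_exp_I_mul_ofReal θ

@[fun_prop] theorem continuous_unitPoint : Continuous unitPoint := by
  unfold unitPoint; fun_prop

theorem unitPoint_zpow (θ : ℝ) (x : ℤ) : unitPoint θ ^ x = Complex.exp (x * Complex.I * θ) := by
  rw [unitPoint, ← Complex.exp_int_mul]; ring_nf

theorem norm_unitPoint_zpow (θ : ℝ) (x : ℤ) : ‖unitPoint θ ^ x‖ = 1 := by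
  rw [norm_zpow, norm_unitPoint, one_zpow]

@[fun_prop] theorem continuous_unitPoint_zpow (x : ℤ) : Continuous fun θ => unitPoint θ ^ x := by
  simp only [unitPoint_zpow]; fun_prop

theorem norm_one_sub_unitPoint_ge {θ : ℝ} (h : |θ| ≤ π) : 2 / π * |θ| ≤ ‖1 - unitPoint θ‖ := by
  rw [norm_sub_rev, unitPoint, Complex.norm_exp_I_mul_ofReal_sub_one, norm_mul, Real.norm_eq_abs,
    Real.norm_eq_abs]
  have := Real.mul_abs_le_abs_sin (x := θ / 2) (by rw [abs_div, abs_two]; linarith)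
  rw [abs_div, abs_two] at this
  rw [abs_two]
  linarith

theorem unitPoint_ne_one {θ : ℝ} (h : |θ| ≤ π) (h0 : θ ≠ 0) : unitPoint θ ≠ 1 := by
  intro he
  have h1 := norm_one_sub_unitPoint_ge h
  rw [he, sub_self, norm_zero] at h1
  have : 0 < 2 / π * |θ| := by have := abs_pos.2 h0; positivity
  linarith

theorem ae_unitPoint_ne_one :
    ∀ᵐ θ : ℝ ∂volume.restrict (Metric.ball 0 π), |θ| < π ∧ θ ≠ 0 := by
  refine (ae_restrict_iff' measurableSet_ball).2 ?_
  filter_upwards [compl_mem_ae_iff.2 (measure_singleton (0 : ℝ))] with θ h0 hθ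
  exact ⟨by simpa using hθ, h0⟩

theorem integrable_amplitude :
    Integrable (fun θ => amplitude (unitPoint θ)) (volume.restrict (Metric.ball 0 π)) := by
  -- The singularity `|θ|^(-1/2)` is integrable in dimension one. The constant comes from `|1 - e| /
  -- 12 ≥ |θ| / (6π)`.
  refine integrableOn_ball_of_norm_le_rpow (C := 3 * √(6 * π)) (α := 1 / 2) (by simp)
    (by norm_num) ?_
    (measurable_amplitude.comp continuous_unitPoint.measurable).aestronglyMeasurable
  filter_upwards [ae_unitPoint_ne_one] with θ ⟨hθ, h0⟩
  refine (norm_amplitude_le (norm_unitPoint θ) (unitPoint_ne_one hθ.le h0)).trans ?_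
  rw [mul_assoc, Real.rpow_neg (norm_nonneg _), ← Real.sqrt_eq_rpow, Real.norm_eq_abs]
  gcongr
  have hpos := abs_pos.2 h0
  have hq : √(6 * π) * (√|θ|)⁻¹ = (√(|θ| / (6 * π)))⁻¹ := by
    rw [Real.sqrt_div (abs_nonneg _), inv_div, div_eq_mul_inv]
  rw [hq]
  have h1 := norm_one_sub_unitPoint_ge hθ.le
  have h2 : |θ| / (6 * π) ≤ ‖1 - unitPoint θ‖ / 12 := by
    calc |θ| / (6 * π) = (2 / π * |θ|) / 12 := by field_simp; norm_num
      _ ≤ _ := by gcongr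
  gcongr

theorem integrable_mode (x y : ℤ) :
    Integrable (fun θ => unitPoint θ ^ x * verticalMode (unitPoint θ) y)
      (volume.restrict (Metric.ball 0 π)) := by
  refine integrable_amplitude.mono ?_ ?_
  · exact ((continuous_unitPoint_zpow x).measurable.mul
      ((measurable_verticalMode y).comp continuous_unitPoint.measurable)).aestronglyMeasurable
  · filter_upwards with θ
    rw [norm_mul, norm_unitPoint_zpow, one_mul]
    exact norm_verticalMode_le _ _

theorem integral_unitPoint_zpow (x : ℤ) :
    ∫ θ in Metric.ball (0 : ℝ) π, unitPoint θ ^ x = if x = 0 then 2 * (π : ℂ) else 0 := by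
  rw [Real.ball_eq_Ioo, zero_sub, zero_add, ← integral_Ioc_eq_integral_Ioo,
    ← intervalIntegral.integral_of_le (by linarith [Real.pi_pos])]
  split_ifs with hx
  · simp [hx]; ring
  · simp only [unitPoint_zpow]
    have hc : (x : ℂ) * Complex.I ≠ 0 := mul_ne_zero (by exact_mod_cast hx) Complex.I_ne_zero
    rw [integral_exp_mul_complex hc, div_eq_zero_iff]
    left
    rw [sub_eq_zero, Complex.exp_eq_exp_iff_exists_int]
    exact ⟨x, by push_cast; ring⟩

/-! ### Bounded potentials with a point charge -/

/-- The transition operator of the simple random walk on `latticeG1`. -/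
noncomputable def latticeStep (F : ℤ × ℤ → ℝ) (v : ℤ × ℤ) : ℝ :=
  (F (v.1, v.2 + 1) + F (v.1, v.2 - 1) + F (if 0 ≤ v.2 then v.1 + 1 else v.1 - 1, v.2)) / 3

/-- `F` is a bounded solution of the Poisson equation with a point charge at `w`. -/
def IsBoundedPotential (w : ℤ × ℤ) (F : ℤ × ℤ → ℝ) : Prop :=
  (∃ C, ∀ v, |F v| ≤ C) ∧ ∀ v, F v - latticeStep F v = if v = w then 1 else 0

/-- The potential kernel of the walk, with the charge at the origin. -/
noncomputable def latticeKernel (v : ℤ × ℤ) : ℂ :=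
  ∫ θ in Metric.ball (0 : ℝ) π, unitPoint θ ^ v.1 * verticalMode (unitPoint θ) v.2

theorem norm_latticeKernel_le (v : ℤ × ℤ) :
    ‖latticeKernel v‖ ≤ ∫ θ in Metric.ball (0 : ℝ) π, ‖amplitude (unitPoint θ)‖ := by
  refine norm_integral_le_of_norm_le integrable_amplitude.norm ?_
  filter_upwards with θ
  rw [norm_mul, norm_unitPoint_zpow, one_mul]
  exact norm_verticalMode_le _ _

/-- A horizontal step multiplies the mode by `e` above and by `e⁻¹ = conj e` below, so
`verticalMode_equation` can be integrated; orthogonality of characters leaves the charge `2π`. -/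
theorem latticeKernel_equation (x y : ℤ) :
    latticeKernel (x, y) - (latticeKernel (x, y + 1) + latticeKernel (x, y - 1) +
      latticeKernel (if 0 ≤ y then x + 1 else x - 1, y)) / 3 =
      if (x, y) = (0, 0) then 2 * (π : ℂ) else 0 := by
  simp only [latticeKernel]
  have i0 := integrable_mode x y
  have i1 := integrable_mode x (y + 1)
  have i2 := integrable_mode x (y - 1)
  have i3 := integrable_mode (if 0 ≤ y then x + 1 else x - 1) y
  rw [← integral_add i1 i2, ← integral_add (i1.fun_add i2) i3, ← integral_div,
    ← integral_sub i0 (((i1.fun_add i2).fun_add i3).div_const 3)]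
  have : ∀ᵐ θ : ℝ ∂volume.restrict (Metric.ball 0 π),
      unitPoint θ ^ x * verticalMode (unitPoint θ) y -
        (unitPoint θ ^ x * verticalMode (unitPoint θ) (y + 1) +
          unitPoint θ ^ x * verticalMode (unitPoint θ) (y - 1) +
          unitPoint θ ^ (if 0 ≤ y then x + 1 else x - 1) * verticalMode (unitPoint θ) y) / 3 =
      if y = 0 then unitPoint θ ^ x else 0 := by
    filter_upwards [ae_unitPoint_ne_one] with θ ⟨hθ, h0⟩
    have hu : unitPoint θ ≠ 0 := norm_ne_zero_iff.1 (by rw [norm_unitPoint]; exact one_ne_zero)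
    have h := verticalMode_equation (norm_unitPoint θ) (unitPoint_ne_one hθ.le h0) y
    have hc : conj (unitPoint θ) = (unitPoint θ)⁻¹ :=
      (Complex.inv_eq_conj (norm_unitPoint θ)).symm
    have hz : unitPoint θ ^ (if 0 ≤ y then x + 1 else x - 1) =
        unitPoint θ ^ x * if 0 ≤ y then unitPoint θ else conj (unitPoint θ) := by
      split_ifs
      · exact zpow_add_one₀ hu x
      · rw [zpow_sub_one₀ hu, hc]
    rw [hz]
    split_ifs at h ⊢ with h3 <;> linear_combination unitPoint θ ^ x * h
  rw [integral_congr_ae this]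
  by_cases hy : y = 0
  · simp [hy, integral_unitPoint_zpow]
  · simp [hy]

theorem isBoundedPotential_latticeKernel :
    IsBoundedPotential (0, 0) fun v => (latticeKernel v).re / (2 * π) := by
  refine ⟨⟨(∫ θ in Metric.ball (0 : ℝ) π, ‖amplitude (unitPoint θ)‖) / (2 * π), fun v => ?_⟩, ?_⟩
  · rw [abs_div, abs_of_pos Real.two_pi_pos]
    have := (Complex.abs_re_le_norm _).trans (norm_latticeKernel_le v)
    gcongr
  · rintro ⟨x, y⟩
    have h := congrArg (fun z : ℂ => z.re / (2 * π)) (latticeKernel_equation x y)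
    have h3 : ∀ z : ℂ, (z / 3).re = z.re / 3 := fun z => by
      simp
    have hr : (((if (x, y) = ((0, 0) : ℤ × ℤ) then 2 * (π : ℂ) else 0) : ℂ).re / (2 * π)) =
        if (x, y) = ((0, 0) : ℤ × ℤ) then 1 else 0 := by
      split_ifs
      · simp [Real.pi_ne_zero]
      · simp
    rw [hr] at h
    rw [← h]
    simp only [latticeStep, Complex.sub_re, h3, Complex.add_re]
    ring

theorem IsBoundedPotential.translate {x y : ℤ} {F : ℤ × ℤ → ℝ} (h : IsBoundedPotential (x, y) F)
    (k : ℤ) : IsBoundedPotential (x + k, y) fun v => F (v.1 - k, v.2) := by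
  obtain ⟨⟨C, hC⟩, hF⟩ := h
  refine ⟨⟨C, fun v => hC _⟩, fun v => ?_⟩
  have h1 := hF (v.1 - k, v.2)
  have hx : (if 0 ≤ v.2 then v.1 + 1 else v.1 - 1) - k =
      if 0 ≤ v.2 then v.1 - k + 1 else v.1 - k - 1 := by split_ifs <;> ring
  simp only [latticeStep] at h1 ⊢
  rw [hx, h1]
  refine if_congr ?_ rfl rfl
  rw [Prod.ext_iff, Prod.ext_iff]
  simp only
  omega

/-- The map `(x, y) ↦ (-x, -1 - y)` is an automorphism of the graph exchanging the two half-planes.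
-/
theorem IsBoundedPotential.reflect {x y : ℤ} {F : ℤ × ℤ → ℝ} (h : IsBoundedPotential (x, y) F) :
    IsBoundedPotential (-x, -1 - y) fun v => F (-v.1, -1 - v.2) := by
  obtain ⟨⟨C, hC⟩, hF⟩ := h
  refine ⟨⟨C, fun v => hC _⟩, fun v => ?_⟩
  have h1 := hF (-v.1, -1 - v.2)
  have hx : -(if 0 ≤ v.2 then v.1 + 1 else v.1 - 1) =
      if 0 ≤ -1 - v.2 then -v.1 + 1 else -v.1 - 1 := by split_ifs <;> omega
  have e1 : -1 - v.2 + 1 = -1 - (v.2 - 1) := by ring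
  have e2 : -1 - v.2 - 1 = -1 - (v.2 + 1) := by ring
  simp only [latticeStep] at h1 ⊢
  rw [e1, e2] at h1
  rw [hx, add_comm (F (-v.1, -1 - (v.2 + 1))), h1]
  refine if_congr ?_ rfl rfl
  rw [Prod.ext_iff, Prod.ext_iff]
  simp only
  omega

/-- Potentials at two consecutive heights give one at the next height. -/
theorem exists_isBoundedPotential_succ {y : ℤ} (hy : 0 ≤ y)
    (h0 : ∀ x, ∃ F, IsBoundedPotential (x, y - 1) F) (h1 : ∀ x, ∃ F, IsBoundedPotential (x, y) F)
    (x : ℤ) : ∃ F, IsBoundedPotential (x, y + 1) F := by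
  obtain ⟨F0, ⟨C0, hC0⟩, h0⟩ := h0 x
  obtain ⟨F1, ⟨C1, hC1⟩, h1'⟩ := h1 x
  obtain ⟨F2, ⟨C2, hC2⟩, h2⟩ := h1 (x - 1)
  -- For `y ≥ 0`, `3 (I - P) δ_(x,y) = 3 δ_(x,y) - δ_(x,y-1) - δ_(x,y+1) - δ_(x-1,y)`, by the
  -- in-neighbours of `(x, y)`. Solve this for `δ_(x,y+1)`.
  refine ⟨fun v => 3 * F1 v - F0 v - F2 v - 3 * if v = (x, y) then 1 else 0,
    ⟨3 * C1 + C0 + C2 + 3, fun v => ?_⟩, fun v => ?_⟩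
  · have a0 := abs_le.1 (hC0 v)
    have a1 := abs_le.1 (hC1 v)
    have a2 := abs_le.1 (hC2 v)
    rw [abs_le]
    dsimp only
    split_ifs <;> constructor <;> linarith
  · have b0 := h0 v
    have b1 := h1' v
    have b2 := h2 v
    obtain ⟨p, q⟩ := v
    simp only [latticeStep, Prod.mk.injEq] at b0 b1 b2 ⊢
    have k1 : (if p = x ∧ q + 1 = y then (1 : ℝ) else 0) = if p = x ∧ q = y - 1 then 1 else 0 :=
      if_congr (by omega) rfl rfl
    have k2 : (if p = x ∧ q - 1 = y then (1 : ℝ) else 0) = if p = x ∧ q = y + 1 then 1 else 0 :=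
      if_congr (by omega) rfl rfl
    have k3 : (if (if 0 ≤ q then p + 1 else p - 1) = x ∧ q = y then (1 : ℝ) else 0) =
        if p = x - 1 ∧ q = y then 1 else 0 :=
      if_congr (by split_ifs <;> omega) rfl rfl
    rw [k1, k2, k3]
    linarith

theorem exists_isBoundedPotential (w : ℤ × ℤ) : ∃ F, IsBoundedPotential w F := by
  have h0 : ∀ x, ∃ F, IsBoundedPotential (x, 0) F := fun x =>
    ⟨_, by simpa using isBoundedPotential_latticeKernel.translate x⟩
  have h1 : ∀ x, ∃ F, IsBoundedPotential (x, -1) F := fun x => by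
    obtain ⟨F, hF⟩ := h0 (-x)
    exact ⟨_, by simpa using hF.reflect⟩
  have up : ∀ k : ℕ, (∀ x, ∃ F, IsBoundedPotential (x, (k : ℤ) - 1) F) ∧
      ∀ x, ∃ F, IsBoundedPotential (x, (k : ℤ)) F := by
    intro k
    induction k with
    | zero => simpa using ⟨h1, h0⟩
    | succ k ih =>
      refine ⟨by simpa using ih.2, ?_⟩
      simpa using exists_isBoundedPotential_succ (Int.natCast_nonneg k) ih.1 ih.2
  obtain ⟨x, y⟩ := w
  rcases le_or_gt 0 y with hy | hy
  · lift y to ℕ using hy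
    exact (up y).2 x
  · obtain ⟨F, hF⟩ := (up (-1 - y).toNat).2 (-x)
    rw [Int.toNat_of_nonneg (by omega)] at hF
    exact ⟨_, by simpa using hF.reflect⟩

/-! ### The walk, the Markov property and transience -/

/-- The out-neighbours of a vertex of `latticeG1`. -/
def latticeNeighbours (v : ℤ × ℤ) : Finset (ℤ × ℤ) :=
  {(v.1, v.2 + 1), (v.1, v.2 - 1), (if 0 ≤ v.2 then v.1 + 1 else v.1 - 1, v.2)}

theorem latticeG1_adj_iff (v w : ℤ × ℤ) : latticeG1.Adj v w ↔ w ∈ latticeNeighbours v := by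
  simp only [latticeG1, latticeNeighbours, Finset.mem_insert, Finset.mem_singleton]
  split_ifs with h
  · simp [h, not_lt.2 h]
  · simp [h, not_le.1 h]

theorem sum_latticeNeighbours {R : Type*} [AddCommMonoid R] (v : ℤ × ℤ) (F : ℤ × ℤ → R) :
    ∑ w ∈ latticeNeighbours v, F w =
      F (v.1, v.2 + 1) + F (v.1, v.2 - 1) + F (if 0 ≤ v.2 then v.1 + 1 else v.1 - 1, v.2) := by
  rw [latticeNeighbours, Finset.sum_insert, Finset.sum_insert, Finset.sum_singleton, add_assoc]
  · simp
  · simp only [Finset.mem_insert, Finset.mem_singleton, Prod.mk.injEq]; omega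

theorem simpleStepProb_latticeG1 (v w : ℤ × ℤ) :
    simpleStepProb latticeG1 v w = if w ∈ latticeNeighbours v then 3⁻¹ else 0 := by
  have : {u | latticeG1.Adj v u}.ncard = 3 := by
    have he : {u | latticeG1.Adj v u} = (latticeNeighbours v : Set (ℤ × ℤ)) :=
      Set.ext fun u => latticeG1_adj_iff v u
    rw [he, Set.ncard_coe_finset, Finset.card_eq_sum_ones, sum_latticeNeighbours]
  rw [simpleStepProb, this]
  simp only [latticeG1_adj_iff, Nat.cast_ofNat]

/-- The event that the walk avoids `w` at the times `1, …, n`. -/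
def avoidSet {Ω : Type*} (M : ℕ → Ω → ℤ × ℤ) (w : ℤ × ℤ) (n : ℕ) : Set Ω :=
  {ω | ∀ k, 1 ≤ k → k ≤ n → M k ω ≠ w}

theorem avoidSet_eq {Ω : Type*} (M : ℕ → Ω → ℤ × ℤ) (w : ℤ × ℤ) (n : ℕ) :
    avoidSet M w n = {ω | (fun i : Fin (n + 1) => M i ω) ∈
      {b : Fin (n + 1) → ℤ × ℤ | ∀ i : Fin (n + 1), 1 ≤ (i : ℕ) → b i ≠ w}} := by
  ext ω
  exact ⟨fun h i hi => h i hi (by omega), fun h k hk hkn => h ⟨k, by omega⟩ hk⟩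

theorem avoidSet_succ {Ω : Type*} (M : ℕ → Ω → ℤ × ℤ) (w : ℤ × ℤ) (n : ℕ) :
    avoidSet M w (n + 1) = avoidSet M w n \ M (n + 1) ⁻¹' {w} := by
  ext ω
  constructor
  · exact fun h => ⟨fun k hk hkn => h k hk (by omega), h (n + 1) (by omega) le_rfl⟩
  · rintro ⟨h, h'⟩ k hk hkn
    rcases Nat.lt_or_eq_of_le hkn with hlt | rfl
    · exact h k hk (by omega)
    · exact h'

section Walk

variable {Ω : Type*} [MeasurableSpace Ω] {μ : Measure Ω}
  {v : ℤ × ℤ} {M : ℕ → Ω → ℤ × ℤ}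

theorem IsSimpleRandomWalk.integrable_comp [IsProbabilityMeasure μ]
    (hM : IsSimpleRandomWalk latticeG1 v μ M)
    {F : ℤ × ℤ → ℝ} {C : ℝ} (hF : ∀ w, |F w| ≤ C) (n : ℕ) : Integrable (fun ω => F (M n ω)) μ :=
  Integrable.of_bound ((measurable_of_countable F).comp (hM.measurable n)).aestronglyMeasurable C
    (Filter.Eventually.of_forall fun _ => hF _)

theorem abs_latticeStep_le {F : ℤ × ℤ → ℝ} {C : ℝ} (hF : ∀ w, |F w| ≤ C) (w : ℤ × ℤ) :
    |latticeStep F w| ≤ C := by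
  have h1 := abs_le.1 (hF (w.1, w.2 + 1))
  have h2 := abs_le.1 (hF (w.1, w.2 - 1))
  have h3 := abs_le.1 (hF (if 0 ≤ w.2 then w.1 + 1 else w.1 - 1, w.2))
  rw [latticeStep, abs_le]
  constructor <;> linarith

theorem IsSimpleRandomWalk.measurableSet_cylinder (hM : IsSimpleRandomWalk latticeG1 v μ M)
    (n : ℕ) (x : ℕ → ℤ × ℤ) : MeasurableSet {ω | ∀ i ≤ n, M i ω = x i} := by
  simp only [Set.ofPred_forall]
  exact .iInter fun i => .iInter fun _ => hM.measurable i (measurableSet_singleton _)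

/-- The Markov property on a cylinder. -/
theorem IsSimpleRandomWalk.setIntegral_cylinder [IsProbabilityMeasure μ]
    (hM : IsSimpleRandomWalk latticeG1 v μ M)
    {F : ℤ × ℤ → ℝ} {C : ℝ} (hF : ∀ w, |F w| ≤ C) (n : ℕ) (x : ℕ → ℤ × ℤ) :
    ∫ ω in {ω | ∀ i ≤ n, M i ω = x i}, F (M (n + 1) ω) ∂μ =
      ∫ ω in {ω | ∀ i ≤ n, M i ω = x i}, latticeStep F (M n ω) ∂μ := by
  set A := {ω | ∀ i ≤ n, M i ω = x i} with hA
  have hAm : MeasurableSet A := hM.measurableSet_cylinder n x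
  have hst (w : ℤ × ℤ) : μ.restrict A (M (n + 1) ⁻¹' {w}) =
      μ A * if w ∈ latticeNeighbours (x n) then 3⁻¹ else 0 := by
    rw [← simpleStepProb_latticeG1, ← hM.markov n x w,
      Measure.restrict_apply (hM.measurable _ (measurableSet_singleton _)), Set.inter_comm]
    rfl
  have hmap : Integrable F ((μ.restrict A).map (M (n + 1))) :=
    (integrable_map_measure (measurable_of_countable F).aestronglyMeasurable
      (hM.measurable _).aemeasurable).2 (hM.integrable_comp hF (n + 1)).integrableOn
  have hR : ∫ ω in A, latticeStep F (M n ω) ∂μ = μ.real A * latticeStep F (x n) := by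
    rw [setIntegral_congr_fun (g := fun _ => latticeStep F (x n)) hAm
      (fun ω hω => by simp only [hω n le_rfl]), setIntegral_const, smul_eq_mul]
  have hterm (w : ℤ × ℤ) : ((μ.restrict A).map (M (n + 1))).real {w} • F w =
      if w ∈ latticeNeighbours (x n) then μ.real A / 3 * F w else 0 := by
    rw [Measure.real, Measure.map_apply (hM.measurable _) (measurableSet_singleton _), hst]
    split_ifs
    · simp [Measure.real, div_eq_mul_inv]
    · simp
  rw [hR, ← integral_map (φ := M (n + 1)) (f := F) (hM.measurable _).aemeasurable
    (measurable_of_countable F).aestronglyMeasurable, integral_countable hmap,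
    tsum_congr hterm, tsum_eq_sum (s := latticeNeighbours (x n))
      (fun w hw => if_neg hw), Finset.sum_congr rfl (fun w hw => if_pos hw),
    sum_latticeNeighbours, latticeStep]
  ring

/-- The Markov property on an event determined by the first `n` steps. -/
theorem IsSimpleRandomWalk.setIntegral_step [IsProbabilityMeasure μ]
    (hM : IsSimpleRandomWalk latticeG1 v μ M)
    {F : ℤ × ℤ → ℝ} {C : ℝ} (hF : ∀ w, |F w| ≤ C) (n : ℕ) (B : Set (Fin (n + 1) → ℤ × ℤ)) :
    ∫ ω in {ω | (fun i : Fin (n + 1) => M i ω) ∈ B}, F (M (n + 1) ω) ∂μ =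
      ∫ ω in {ω | (fun i : Fin (n + 1) => M i ω) ∈ B}, latticeStep F (M n ω) ∂μ := by
  let S : B → Set Ω := fun b =>
    -- Cylinders are indexed by infinite paths; the value `0` after time `n` is arbitrary.
    {ω | ∀ i ≤ n, M i ω = if h : i < n + 1 then (b : Fin (n + 1) → ℤ × ℤ) ⟨i, h⟩ else 0}
  have hS (b : B) (ω : Ω) : ω ∈ S b ↔ (fun i : Fin (n + 1) => M i ω) = b := by
    constructor
    · intro h
      funext i
      exact (h i (by omega)).trans (dif_pos i.2)
    · intro h i hi
      rw [dif_pos (by omega), ← h]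
  have hU : {ω | (fun i : Fin (n + 1) => M i ω) ∈ B} = ⋃ b, S b := by
    ext ω
    simp only [Set.mem_ofPred_eq, Set.mem_iUnion, hS]
    exact ⟨fun h => ⟨⟨_, h⟩, rfl⟩, fun ⟨b, hb⟩ => hb ▸ b.2⟩
  have hm (b : B) : MeasurableSet (S b) := hM.measurableSet_cylinder n _
  have hd : Pairwise (Function.onFun Disjoint S) := fun b c hbc =>
    Set.disjoint_left.2 fun ω h1 h2 =>
      hbc (Subtype.ext (((hS b ω).1 h1).symm.trans ((hS c ω).1 h2)))
  rw [hU, integral_iUnion hm hd (hM.integrable_comp hF _).integrableOn,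
    integral_iUnion hm hd (hM.integrable_comp (abs_latticeStep_le hF) _).integrableOn]
  exact tsum_congr fun b => hM.setIntegral_cylinder hF n _

theorem IsSimpleRandomWalk.setIntegral_potential [IsProbabilityMeasure μ]
    (hM : IsSimpleRandomWalk latticeG1 v μ M)
    {F : ℤ × ℤ → ℝ} {w : ℤ × ℤ} (hF : IsBoundedPotential w F) (n : ℕ)
    (B : Set (Fin (n + 1) → ℤ × ℤ)) :
    ∫ ω in {ω | (fun i : Fin (n + 1) => M i ω) ∈ B}, F (M (n + 1) ω) ∂μ =
      ∫ ω in {ω | (fun i : Fin (n + 1) => M i ω) ∈ B}, F (M n ω) ∂μ -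
        μ.real ({ω | (fun i : Fin (n + 1) => M i ω) ∈ B} ∩ M n ⁻¹' {w}) := by
  obtain ⟨⟨C, hC⟩, hF⟩ := hF
  set A := {ω | (fun i : Fin (n + 1) => M i ω) ∈ B}
  have hwm : MeasurableSet (M n ⁻¹' {w}) := hM.measurable n (measurableSet_singleton w)
  have hAm : MeasurableSet A :=
    (measurable_pi_lambda _ fun i : Fin (n + 1) => hM.measurable i) (Set.to_countable B).measurableSet
  have h (ω : Ω) : latticeStep F (M n ω) = F (M n ω) - (M n ⁻¹' {w}).indicator (1 : Ω → ℝ) ω := by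
    have := hF (M n ω)
    by_cases hw : M n ω = w
    · rw [Set.indicator_of_mem (by exact hw), Pi.one_apply]
      rw [if_pos hw] at this
      linarith
    · rw [Set.indicator_of_notMem (by exact hw)]
      rw [if_neg hw] at this
      linarith
  rw [hM.setIntegral_step hC n B]
  simp only [h]
  have i1 : Integrable ((M n ⁻¹' {w}).indicator (1 : Ω → ℝ)) (μ.restrict A) :=
    (integrable_const (1 : ℝ)).indicator hwm
  rw [integral_sub (hM.integrable_comp hC n).integrableOn i1, integral_indicator_one hwm,
    measureReal_restrict_apply hwm, Set.inter_comm]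

theorem IsSimpleRandomWalk.sum_measure_eq [IsProbabilityMeasure μ]
    (hM : IsSimpleRandomWalk latticeG1 v μ M)
    {F : ℤ × ℤ → ℝ} {w : ℤ × ℤ} (hF : IsBoundedPotential w F) (n : ℕ) :
    ∑ k ∈ Finset.range n, μ.real {ω | M k ω = w} = ∫ ω, F (M 0 ω) ∂μ - ∫ ω, F (M n ω) ∂μ := by
  induction n with
  | zero => simp
  | succ n ih =>
    have h := hM.setIntegral_potential hF n Set.univ
    simp only [Set.mem_univ, Set.ofPred_true, Measure.restrict_univ, Set.univ_inter] at h
    rw [Finset.sum_range_succ, ih, h]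
    change _ = _ - (_ - μ.real {ω | M n ω = w})
    ring

theorem IsSimpleRandomWalk.tsum_measure_lt_top [IsProbabilityMeasure μ]
    (hM : IsSimpleRandomWalk latticeG1 v μ M)
    (w : ℤ × ℤ) : ∑' n : ℕ, μ {ω | M n ω = w} < ∞ := by
  obtain ⟨F, hF⟩ := exists_isBoundedPotential w
  obtain ⟨C, hC⟩ := hF.1
  have hb (n : ℕ) : |∫ ω, F (M n ω) ∂μ| ≤ C := by
    rw [← Real.norm_eq_abs]
    refine (norm_integral_le_of_norm_le_const (C := C)
      (Filter.Eventually.of_forall fun ω => ?_)).trans_eq (by simp)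
    exact hC (M n ω)
  have hs : Summable fun n => μ.real {ω | M n ω = w} := by
    refine summable_of_sum_range_le (c := 2 * C) (fun _ => measureReal_nonneg) fun n => ?_
    rw [hM.sum_measure_eq hF n]
    have h0 := abs_le.1 (hb 0)
    have h1 := abs_le.1 (hb n)
    linarith
  rw [lt_top_iff_ne_top]
  have : (fun n => μ {ω | M n ω = w}) = fun n => ENNReal.ofReal (μ.real {ω | M n ω = w}) := by
    funext n; rw [ofReal_measureReal]
  rw [this]
  exact hs.tsum_ofReal_ne_top

theorem IsSimpleRandomWalk.measurableSet_avoidSet (hM : IsSimpleRandomWalk latticeG1 v μ M)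
    (w : ℤ × ℤ) (n : ℕ) : MeasurableSet (avoidSet M w n) := by
  rw [avoidSet_eq]
  exact (measurable_pi_lambda _ fun i : Fin (n + 1) => hM.measurable i)
    (Set.to_countable _).measurableSet

/-- Optional stopping for the potential at the starting point, at the first return time. -/
theorem IsSimpleRandomWalk.setIntegral_avoidSet [IsProbabilityMeasure μ]
    (hM : IsSimpleRandomWalk latticeG1 v μ M)
    {F : ℤ × ℤ → ℝ} (hF : IsBoundedPotential v F) (n : ℕ) :
    ∫ ω in avoidSet M v n, F (M (n + 1) ω) ∂μ = F v * μ.real (avoidSet M v n) - 1 := by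
  obtain ⟨C, hC⟩ := hF.1
  have hset (m : ℕ) := hM.setIntegral_potential hF m
    {b : Fin (m + 1) → ℤ × ℤ | ∀ i : Fin (m + 1), 1 ≤ (i : ℕ) → b i ≠ v}
  simp only [← avoidSet_eq] at hset
  induction n with
  | zero =>
    rw [hset]
    have h0 : avoidSet M v 0 = Set.univ :=
      Set.eq_univ_of_forall fun ω k hk hk0 => absurd (hk.trans hk0) (by norm_num)
    have h1 : ∫ ω, F (M 0 ω) ∂μ = F v := by
      rw [integral_congr_ae (g := fun _ => F v) (hM.start.mono fun ω h => by simp only [h])]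
      simp
    -- Avoidance only starts at time `1`, so the charge is met once, at time `0`: this is the `-1`.
    have h2 : μ.real (M 0 ⁻¹' {v}) = 1 := by
      rw [Measure.real, (prob_compl_eq_zero_iff (hM.measurable 0 (measurableSet_singleton v))).1]
      · simp
      · exact hM.start
    rw [h0, Measure.restrict_univ, Set.univ_inter, h1, h2]
    simp
  | succ n ih =>
    have hwm : MeasurableSet (M (n + 1) ⁻¹' {v}) := hM.measurable _ (measurableSet_singleton v)
    have hAm := hM.measurableSet_avoidSet v n
    have he : avoidSet M v (n + 1) ∩ M (n + 1) ⁻¹' {v} = ∅ := by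
      rw [avoidSet_succ]; exact Set.sdiff_inter_self
    rw [hset, he, measureReal_empty, sub_zero]
    have hsplit := integral_inter_add_sdiff (s := avoidSet M v n) hwm
      (hM.integrable_comp hC (n + 1)).integrableOn
    -- Paths returning at time `n + 1` leave with the value `F v`, exactly the loss in the term `F v
    -- * μ.real (avoidSet M v n)`.
    have hconst : ∫ ω in avoidSet M v n ∩ M (n + 1) ⁻¹' {v}, F (M (n + 1) ω) ∂μ =
        μ.real (avoidSet M v n ∩ M (n + 1) ⁻¹' {v}) * F v := by
      rw [setIntegral_congr_fun (g := fun _ => F v) (hAm.inter hwm)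
        (fun ω hω => by rw [show M (n + 1) ω = v from hω.2]), setIntegral_const, smul_eq_mul]
    have hm := measureReal_inter_add_sdiff (μ := μ) (s := avoidSet M v n) hwm
    rw [ih, hconst, ← avoidSet_succ] at hsplit
    rw [← avoidSet_succ] at hm
    rw [← hm] at hsplit
    linarith

theorem IsSimpleRandomWalk.measure_return_lt_one [IsProbabilityMeasure μ]
    (hM : IsSimpleRandomWalk latticeG1 v μ M) :
    μ {ω | ∃ n : ℕ, 1 ≤ n ∧ M n ω = v} < 1 := by
  obtain ⟨F, hF⟩ := exists_isBoundedPotential v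
  obtain ⟨C, hC⟩ := hF.1
  have hlow (n : ℕ) : 1 ≤ 2 * C * μ.real (avoidSet M v n) := by
    have h := hM.setIntegral_avoidSet hF n
    have hb : |∫ ω in avoidSet M v n, F (M (n + 1) ω) ∂μ| ≤ C * μ.real (avoidSet M v n) := by
      rw [← Real.norm_eq_abs]
      exact norm_setIntegral_le_of_norm_le_const (measure_lt_top _ _) fun ω _ => hC (M (n + 1) ω)
    have h1 := abs_le.1 hb
    have h2 : F v * μ.real (avoidSet M v n) ≤ C * μ.real (avoidSet M v n) :=
      mul_le_mul_of_nonneg_right (abs_le.1 (hC v)).2 measureReal_nonneg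
    linarith
  have hcompl : {ω | ∃ n : ℕ, 1 ≤ n ∧ M n ω = v}ᶜ = ⋂ n, avoidSet M v n := by
    ext ω
    simp only [Set.mem_compl_iff, Set.mem_ofPred_eq, not_exists, not_and, Set.mem_iInter, avoidSet]
    exact ⟨fun h _ k hk _ => h k hk, fun h n hn => h n n hn le_rfl⟩
  have hanti : Antitone (avoidSet M v) := fun m n hmn ω h k hk hkm => h k hk (hkm.trans hmn)
  have hlim := tendsto_measure_iInter_atTop (μ := μ)
    (fun n => (hM.measurableSet_avoidSet v n).nullMeasurableSet) hanti
    ⟨0, measure_ne_top _ _⟩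
  have hlim' := (ENNReal.tendsto_toReal (measure_ne_top _ _)).comp hlim
  -- In the limit, `1 ≤ 2C` times the probability of never returning, which therefore cannot vanish.
  have h1 := ge_of_tendsto' (hlim'.const_mul (2 * C)) hlow
  have hR : MeasurableSet {ω | ∃ n : ℕ, 1 ≤ n ∧ M n ω = v} := by
    rw [← MeasurableSet.compl_iff, hcompl]
    exact .iInter fun n => hM.measurableSet_avoidSet v n
  refine prob_le_one.lt_of_ne fun h => ?_
  rw [← prob_compl_eq_zero_iff hR, hcompl] at h
  rw [h] at h1
  norm_num at h1

end Walk

theorem mainTheorem6 {Ω : Type*} [MeasurableSpace Ω] (μ : Measure Ω) [IsProbabilityMeasure μ]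
    (v : ℤ × ℤ) (M : ℕ → Ω → ℤ × ℤ) (hM : IsSimpleRandomWalk latticeG1 v μ M) :
    μ {ω | ∃ n : ℕ, 1 ≤ n ∧ M n ω = v} < 1 ∧ ∑' n : ℕ, μ {ω | M n ω = v} < ∞ :=
  ⟨hM.measure_return_lt_one, hM.tsum_measure_lt_top v⟩
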